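/- Let $q\in[0,1]$, $p=1-q$, let $\Omega=\{0,1\}^{\mathbb Z}$ and let $\pi$ be the product over $\mathbb Z$ of Bernoulli$(1-q)$ measures, so that $\pi(\sigma(x)=1)=p$ for each $x$. The East process on $\mathbb Z$ is the càdlàg Markov process $(\sigma_s)_{s\ge 0}$ on $\Omega$ whose generator acts on local functions $f$ (those that depend on finitely many coordinates) as $$\mathcal L f(\sigma)=\sum_{x\in\mathbb Z}c_x(\sigma)\,[\pi_x(f)(\sigma)-f(\sigma)],\qquad c_x(\sigma)=1-\sigma(x+1),$$ where $\pi_x(f)$ and $\operatorname{Var}_x(f)$ are the mean and the variance of $f$ over the Bernoulli$(1-q)$ spin at $x$, with the other spins kept fixed. Precisely, its law $\mathbb P_\eta$ on the space of càdlàg paths, when started from $\eta\in\Omega$, is the solution of the martingale problem for $\mathcal L$: $\sigma_0=\eta$ almost surely, and $f(\sigma_t)-f(\sigma_0)-\int_0^t\mathcal L f(\sigma_s)\,ds$ is a martingale for each local $f$. Let $$\mathcal D(f)=\sum_{x\in\mathbb Z}\pi\bigl(c_x\operatorname{Var}_x(f)\bigr),\qquad \operatorname{gap}(\mathcal L)=\inf_f\frac{\mathcal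 D(f)}{\operatorname{Var}_\pi(f)},$$ the infimum running over the local functions $f$ that are not $\pi$-almost surely constant (for $q\in\{0,1\}$ there are none, and the infimum is then taken to be $0$; its value does not matter, as $\min(p,q)=0$). Let $$F(t)=\int d\pi(\eta)\,\mathbb P_\eta\bigl(\sigma_s(0)=\eta(0)\ \text{for all } s\le t\bigr)$$ be the equilibrium persistence function, where $\sigma_s(0)$ is the spin at the origin at time $s$. Then $$F(t)\le 2\exp\Bigl(-\frac{\operatorname{gap}(\mathcal L)\,\min(p,q)}{4}\,t\Bigr)\qquad\text{for all } t\ge 0 .$$ -/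

import Mathlib

open MeasureTheory ProbabilityTheory Filter Topology
open scoped NNReal

namespace East

/-- Configurations on `ℤ`: `σ x = true` means that `x` is filled (the spin is `1`), `σ x = false`
that `x` is empty (the spin is `0`). -/
abbrev Config : Type := ℤ → Bool

/-- The law `π_x` of a single spin: Bernoulli`(1 - q)`, with mass `p = 1 - q` on filled and `q` on
empty. -/
noncomputable def siteLaw (q : unitInterval) : Measure Bool :=
  bernoulliMeasure true false (unitInterval.symm q)

instance instIsProbabilityMeasureSiteLaw (q : unitInterval) :
    IsProbabilityMeasure (siteLaw q) := by
  unfold siteLaw; infer_instance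

/-- The product Bernoulli`(1 - q)` measure `π` on configurations. -/
noncomputable def eqLaw (q : unitInterval) : Measure Config :=
  Measure.infinitePi fun _ : ℤ => siteLaw q

/-- A local function depends on finitely many spins. -/
def IsLocal (f : Config → ℝ) : Prop := ∃ S : Finset ℤ, DependsOn f (S : Set ℤ)

/-- The constraint `c_x(σ) = 1 - σ(x + 1)`. -/
def constraint (x : ℤ) (σ : Config) : ℝ := if σ (x + 1) then 0 else 1

/-- `π_x(f)(σ)`: the mean of `f` over the spin at `x`, the other spins being those of `σ`. -/
noncomputable def siteMean (q : unitInterval) (x : ℤ) (f : Config → ℝ) (σ : Config) : ℝ :=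
  ∫ b, f (Function.update σ x b) ∂(siteLaw q)

/-- `Var_x(f)(σ)`: the variance of `f` over the spin at `x`, the other spins being those of `σ`. -/
noncomputable def siteVar (q : unitInterval) (x : ℤ) (f : Config → ℝ) (σ : Config) : ℝ :=
  variance (fun b => f (Function.update σ x b)) (siteLaw q)

/-- The generator of the East process, used on local functions `f`, for which only finitely many
terms of the sum are nonzero. -/
noncomputable def gen (q : unitInterval) (f : Config → ℝ) (σ : Config) : ℝ :=
  ∑' x : ℤ, constraint x σ * (siteMean q x f σ - f σ)

/-- The Dirichlet form `D(f) = ∑_x π(c_x Var_x(f))`, used on local functions `f`, for which only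
finitely many terms of the sum are nonzero. -/
noncomputable def dirichlet (q : unitInterval) (f : Config → ℝ) : ℝ :=
  ∑' x : ℤ, ∫ σ, constraint x σ * siteVar q x f σ ∂(eqLaw q)

/-- The spectral gap of the generator: the infimum of `D(f) / Var(f)` over the local functions `f`
that are not `π`-almost surely constant. -/
noncomputable def gap (q : unitInterval) : ℝ :=
  sInf {r : ℝ | ∃ f : Config → ℝ,
    IsLocal f ∧ variance f (eqLaw q) ≠ 0 ∧ r = dirichlet q f / variance f (eqLaw q)}

/-- The path space `D([0,∞), Config)`: right-continuous functions with left limits. -/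
def Path : Type :=
  {ω : ℝ≥0 → Config //
    ∀ t, ContinuousWithinAt ω (Set.Ici t) t ∧ ∃ σ, Tendsto ω (𝓝[<] t) (𝓝 σ)}

namespace Path

/-- The configuration at time `t`. -/
def at_ (ω : Path) (t : ℝ≥0) : Config := ω.1 t

/-- The σ-algebra on path space generated by the coordinate maps (it is the Borel σ-algebra of the
Skorokhod topology). -/
instance instMeasurableSpace : MeasurableSpace Path :=
  ⨆ t : ℝ≥0, MeasurableSpace.comap (fun ω : Path => ω.at_ t) inferInstance

/-- The canonical filtration on path space. -/
def canonicalFiltration : Filtration ℝ≥0 instMeasurableSpace where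
  seq t := ⨆ s : ℝ≥0, ⨆ _ : s ≤ t,
    MeasurableSpace.comap (fun ω : Path => ω.at_ s) inferInstance
  mono' _ _ h := iSup₂_le fun s hs => le_iSup₂_of_le s (hs.trans h) le_rfl
  le' _ := iSup₂_le fun s _ =>
    le_iSup (fun s : ℝ≥0 => MeasurableSpace.comap (fun ω : Path => ω.at_ s) inferInstance) s

end Path

/-- The kernel `η ↦ P η` consists of the laws on path space of the East process started from `η`:
under `P η` the path starts from `η` almost surely, and it solves the martingale problem of the
generator on local functions. -/
structure IsEastProcess (q : unitInterval) (P : Kernel Config Path) : Prop where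
  isMarkovKernel : IsMarkovKernel P
  initial : ∀ η, ∀ᵐ ω ∂(P η), ω.at_ 0 = η
  martingale : ∀ η, ∀ f : Config → ℝ, IsLocal f →
    Martingale
      (fun (t : ℝ≥0) (ω : Path) =>
        f (ω.at_ t) - f (ω.at_ 0) - ∫ s in (0 : ℝ)..t, gen q f (ω.at_ s.toNNReal))
      Path.canonicalFiltration (P η)

/-- The equilibrium persistence function
`F(t) = ∫ dπ(η) P_η(σ_s(0) = η(0) for all s ≤ t)`. -/
noncomputable def persistence (q : unitInterval) (P : Kernel Config Path) (t : ℝ≥0) : ℝ :=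
  ∫ η, (P η).real {ω : Path | ∀ s ≤ t, ω.at_ s 0 = η 0} ∂(eqLaw q)

end East

namespace East

open scoped Nat

/-! Sample the path at times `0, h, …, n h = t`. Persistence forces the origin to show one value `b`
at all of them, and the two values of `b` give the factor 2. Let `T` be the semigroup and `κ =
min(p, q)`. If `g` vanishes off `{σ(0) = b}`, Cauchy-Schwarz bounds its squared mean by `(1 -
κ)‖g‖²`, and the gap contracts its variance by `exp(-2 gap h)`. Hence `‖T_h g‖² ≤ r ‖g‖²` with `r =
1 - κ(1 - exp(-2 gap h))`. Conditioning on the past once per step gives `r ^ (n/2)`, which is at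
most `exp(-gap κ t / 2)` for small `h`; this is stronger than needed.

The process is given only by its martingale problem, so `T_h` is replaced by its Taylor polynomials.
Local functions are analytic vectors, which makes these converge for `h ≤ 1/8`. The polynomials are
again local, so the gap inequality applies to them directly and an energy estimate gives the decay
up to a vanishing error (`exists_integral_sq_taylorGen_le`). Iterating the martingale identity on an
event of the past gives the Markov property in the form of a limit
(`IsEastProcess.tendsto_setIntegral_taylorGen`). `IsEastProcess.abs_setIntegral_stayEvent_le`
combines the two by induction on the number of steps. -/

/-! ### Single-site averages and the constraint. -/

theorem integral_siteLaw (q : unitInterval) (g : Bool → ℝ) :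
    ∫ b, g b ∂(siteLaw q) = (1 - (q : ℝ)) * g true + q * g false := by
  simp [siteLaw, integral_bernoulliMeasure]

theorem siteMean_eq (q : unitInterval) (x : ℤ) (f : Config → ℝ) (σ : Config) :
    siteMean q x f σ =
      (1 - (q : ℝ)) * f (Function.update σ x true) + q * f (Function.update σ x false) :=
  integral_siteLaw q _

theorem siteVar_eq (q : unitInterval) (x : ℤ) (f : Config → ℝ) (σ : Config) :
    siteVar q x f σ = (1 - (q : ℝ)) * q *
      (f (Function.update σ x true) - f (Function.update σ x false)) ^ 2 := by
  rw [siteVar, variance_eq_integral (measurable_of_finite _).aemeasurable, integral_siteLaw, integral_siteLaw]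
  ring

theorem siteVar_nonneg (q : unitInterval) (x : ℤ) (f : Config → ℝ) (σ : Config) :
    0 ≤ siteVar q x f σ :=
  variance_nonneg _ _

theorem constraint_nonneg (x : ℤ) (σ : Config) : 0 ≤ constraint x σ := by
  unfold constraint; split_ifs <;> norm_num

theorem constraint_le_one (x : ℤ) (σ : Config) : constraint x σ ≤ 1 := by
  unfold constraint; split_ifs <;> norm_num

theorem update_eqOn {S : Set ℤ} {σ τ : Config} (h : ∀ i ∈ S, σ i = τ i) (x : ℤ) (b : Bool) :
    ∀ i ∈ S, Function.update σ x b i = Function.update τ x b i := by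
  intro i hi
  by_cases hx : i = x
  · subst hx; simp
  · simp [Function.update_of_ne hx, h i hi]

theorem apply_update_of_notMem {f : Config → ℝ} {S : Set ℤ} (hf : DependsOn f S) {x : ℤ}
    (hx : x ∉ S) (σ : Config) (b : Bool) : f (Function.update σ x b) = f σ :=
  hf fun _ hi => Function.update_of_ne (ne_of_mem_of_not_mem hi hx) _ _

theorem siteMean_of_notMem (q : unitInterval) {f : Config → ℝ} {S : Set ℤ} (hf : DependsOn f S)
    {x : ℤ} (hx : x ∉ S) (σ : Config) : siteMean q x f σ = f σ := by
  rw [siteMean_eq, apply_update_of_notMem hf hx, apply_update_of_notMem hf hx]; ring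

theorem siteVar_of_notMem (q : unitInterval) {f : Config → ℝ} {S : Set ℤ} (hf : DependsOn f S)
    {x : ℤ} (hx : x ∉ S) (σ : Config) : siteVar q x f σ = 0 := by
  rw [siteVar_eq, apply_update_of_notMem hf hx, apply_update_of_notMem hf hx]; ring

theorem dependsOn_siteMean (q : unitInterval) {f : Config → ℝ} {S : Set ℤ} (hf : DependsOn f S)
    (x : ℤ) : DependsOn (siteMean q x f) S := by
  intro σ τ h
  rw [siteMean_eq, siteMean_eq, hf (update_eqOn h x true), hf (update_eqOn h x false)]

theorem isLocal_constraint (x : ℤ) : IsLocal (constraint x) :=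
  ⟨{x + 1}, fun σ τ h => by simp [constraint, h (x + 1) (by simp)]⟩

theorem gen_eq_sum (q : unitInterval) {f : Config → ℝ} {S : Finset ℤ}
    (hf : DependsOn f (S : Set ℤ)) (σ : Config) :
    gen q f σ = ∑ x ∈ S, constraint x σ * (siteMean q x f σ - f σ) :=
  tsum_eq_sum fun x hx => by rw [siteMean_of_notMem q hf (by simpa using hx)]; ring

/-! ### The algebra of local functions. -/

namespace IsLocal

theorem map₂ {f g : Config → ℝ} (hf : IsLocal f) (hg : IsLocal g) (F : ℝ → ℝ → ℝ) :
    IsLocal fun σ => F (f σ) (g σ) := by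
  obtain ⟨S, hS⟩ := hf
  obtain ⟨T, hT⟩ := hg
  refine ⟨S ∪ T, fun σ τ h => ?_⟩
  beta_reduce
  rw [hS fun i hi => h i (by simp_all), hT fun i hi => h i (by simp_all)]

protected theorem const (c : ℝ) : IsLocal fun _ => c := ⟨∅, fun _ _ _ => rfl⟩

protected theorem mul {f g : Config → ℝ} (hf : IsLocal f) (hg : IsLocal g) :
    IsLocal fun σ => f σ * g σ := hf.map₂ hg (· * ·)

protected theorem add {f g : Config → ℝ} (hf : IsLocal f) (hg : IsLocal g) :
    IsLocal fun σ => f σ + g σ := hf.map₂ hg (· + ·)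

protected theorem sub {f g : Config → ℝ} (hf : IsLocal f) (hg : IsLocal g) :
    IsLocal fun σ => f σ - g σ := hf.map₂ hg (· - ·)

protected theorem sum {ι : Type*} (K : Finset ι) {v : ι → Config → ℝ}
    (hv : ∀ k ∈ K, IsLocal (v k)) : IsLocal fun σ => ∑ k ∈ K, v k σ := by
  classical
  induction K using Finset.induction_on with
  | empty => simpa using IsLocal.const 0
  | insert a K ha ih =>
    simp only [Finset.sum_insert ha]
    exact (hv a (by simp)).add (ih fun k hk => hv k (by simp [hk]))

theorem siteMean {f : Config → ℝ} (hf : IsLocal f) (q : unitInterval) (x : ℤ) :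
    IsLocal (siteMean q x f) := hf.imp fun _ hS => dependsOn_siteMean q hS x

theorem gen {f : Config → ℝ} (hf : IsLocal f) (q : unitInterval) : IsLocal (gen q f) := by
  obtain ⟨S, hS⟩ := hf
  rw [funext (gen_eq_sum q hS)]
  exact IsLocal.sum _ fun x _ => (isLocal_constraint x).mul
    (IsLocal.sub (IsLocal.siteMean ⟨S, hS⟩ q x) ⟨S, hS⟩)

theorem iterate_gen {f : Config → ℝ} (hf : IsLocal f) (q : unitInterval) (k : ℕ) :
    IsLocal ((East.gen q)^[k] f) := by
  induction k with
  | zero => exact hf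
  | succ k ih => rw [Function.iterate_succ_apply']; exact ih.gen q

/-- Factoring through a finite cube makes measurability and boundedness automatic. -/
theorem exists_comp_restrict {f : Config → ℝ} (hf : IsLocal f) :
    ∃ (S : Finset ℤ) (g : (S → Bool) → ℝ), f = fun σ => g fun i => σ i := by
  obtain ⟨S, hS⟩ := hf
  refine ⟨S, fun τ => f fun i => if h : i ∈ S then τ ⟨i, h⟩ else false, funext fun σ => hS ?_⟩
  intro i hi
  simp [Finset.mem_coe.1 hi]

theorem measurable {f : Config → ℝ} (hf : IsLocal f) : Measurable f := by
  obtain ⟨S, g, rfl⟩ := hf.exists_comp_restrict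
  exact (measurable_of_finite g).comp (by fun_prop)

theorem exists_bound {f : Config → ℝ} (hf : IsLocal f) : ∃ C, ∀ σ, |f σ| ≤ C := by
  obtain ⟨S, g, rfl⟩ := hf.exists_comp_restrict
  obtain ⟨C, hC⟩ := (Set.finite_range fun τ => |g τ|).bddAbove
  exact ⟨C, fun σ => hC ⟨_, rfl⟩⟩

theorem integrable {f : Config → ℝ} (hf : IsLocal f) (μ : Measure Config) [IsFiniteMeasure μ] :
    Integrable f μ := by
  obtain ⟨C, hC⟩ := hf.exists_bound
  exact Integrable.of_bound hf.measurable.aestronglyMeasurable C (by simpa using ae_of_all _ hC)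

theorem memLp {f : Config → ℝ} (hf : IsLocal f) (μ : Measure Config) [IsFiniteMeasure μ] :
    MemLp f 2 μ := by
  obtain ⟨C, hC⟩ := hf.exists_bound
  exact MemLp.of_bound hf.measurable.aestronglyMeasurable C (by simpa using ae_of_all _ hC)

theorem exists_dependsOn_Ico {f : Config → ℝ} (hf : IsLocal f) :
    ∃ (a : ℤ) (n : ℕ), DependsOn f (Finset.Ico a (a + (n + 1 : ℕ)) : Set ℤ) := by
  obtain ⟨S, hS⟩ := hf
  obtain ⟨a, ha⟩ := S.bddBelow
  obtain ⟨b, hb⟩ := S.bddAbove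
  refine ⟨a, (b - a).toNat, hS.mono fun x hx => ?_⟩
  have h1 := ha hx
  have h2 := hb hx
  simp only [Finset.coe_Ico, Set.mem_Ico]
  push_cast
  omega

end IsLocal

/-! ### Iterates of the generator on local functions. -/

theorem gen_sum_mul (q : unitInterval) {ι : Type*} (K : Finset ι) (c : ι → ℝ)
    {v : ι → Config → ℝ} (hv : ∀ k, IsLocal (v k)) (σ : Config) :
    gen q (fun σ => ∑ k ∈ K, c k * v k σ) σ = ∑ k ∈ K, c k * gen q (v k) σ := by
  classical
  choose S hS using hv
  have hK : ∀ k ∈ K, DependsOn (v k) (K.biUnion S : Set ℤ) := fun k hk =>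
    (hS k).mono fun i hi => by
      simp only [Finset.coe_biUnion, Set.mem_iUnion]; exact ⟨k, hk, hi⟩
  have hsum : DependsOn (fun σ => ∑ k ∈ K, c k * v k σ) (K.biUnion S : Set ℤ) :=
    fun σ τ h => Finset.sum_congr rfl fun k hk => by rw [hK k hk h]
  have h : ∀ k ∈ K, c k * gen q (v k) σ =
      ∑ x ∈ K.biUnion S, c k * (constraint x σ * (siteMean q x (v k) σ - v k σ)) := fun k hk => by
    rw [gen_eq_sum q (hK k hk) σ, Finset.mul_sum]
  rw [gen_eq_sum q hsum, Finset.sum_congr rfl h, Finset.sum_comm]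
  refine Finset.sum_congr rfl fun x _ => ?_
  simp_rw [siteMean_eq, Finset.mul_sum, ← Finset.sum_add_distrib, ← Finset.sum_sub_distrib,
    Finset.mul_sum]
  exact Finset.sum_congr rfl fun k _ => by ring

/-- The constraint at `x` looks only at `x + 1`, so the support grows by a single site, on the
right. This linear growth keeps the iterates of order `k!` up to a geometric factor. -/
theorem dependsOn_gen (q : unitInterval) {f : Config → ℝ} {a : ℤ} {n : ℕ}
    (hf : DependsOn f (Finset.Ico a (a + n) : Set ℤ)) :
    DependsOn (gen q f) (Finset.Ico a (a + (n + 1 : ℕ)) : Set ℤ) := by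
  intro σ τ h
  have hf' := hf.mono (t := (Finset.Ico a (a + (n + 1 : ℕ)) : Set ℤ))
    (fun x hx => by simp at hx ⊢; omega)
  rw [gen_eq_sum q hf, gen_eq_sum q hf, hf' h]
  refine Finset.sum_congr rfl fun x hx => ?_
  rw [dependsOn_siteMean q hf' x h, constraint, constraint, h (x + 1) (by simp at hx ⊢; omega)]

theorem abs_gen_le (q : unitInterval) {f : Config → ℝ} {a : ℤ} {n : ℕ}
    (hf : DependsOn f (Finset.Ico a (a + n) : Set ℤ)) {C : ℝ} (hC : ∀ σ, |f σ| ≤ C)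
    (σ : Config) : |gen q f σ| ≤ 2 * n * C := by
  have hq := q.2
  have key : ∀ x, |constraint x σ * (siteMean q x f σ - f σ)| ≤ 2 * C := by
    intro x
    rw [abs_mul, abs_of_nonneg (constraint_nonneg x σ)]
    have h1 : |siteMean q x f σ| ≤ C := by
      rw [siteMean_eq, abs_le]
      have h2 := abs_le.1 (hC (Function.update σ x true))
      have h3 := abs_le.1 (hC (Function.update σ x false))
      constructor <;> nlinarith [hq.1, hq.2]
    calc _ ≤ 1 * |siteMean q x f σ - f σ| := by
          gcongr; exact constraint_le_one x σ
      _ ≤ |siteMean q x f σ| + |f σ| := by rw [one_mul]; exact abs_sub _ _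
      _ ≤ 2 * C := by linarith [hC σ]
  rw [gen_eq_sum q hf]
  calc _ ≤ ∑ x ∈ Finset.Ico a (a + n), |constraint x σ * (siteMean q x f σ - f σ)| :=
        Finset.abs_sum_le_sum_abs _ _
    _ ≤ ∑ x ∈ Finset.Ico a (a + n), 2 * C := Finset.sum_le_sum fun x _ => key x
    _ = 2 * n * C := by simp; ring

theorem abs_iterate_gen_le (q : unitInterval) {f : Config → ℝ} {a : ℤ} {n : ℕ}
    (hf : DependsOn f (Finset.Ico a (a + n) : Set ℤ)) {C : ℝ} (hC : ∀ σ, |f σ| ≤ C) (k : ℕ) :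
    DependsOn ((gen q)^[k] f) (Finset.Ico a (a + (n + k : ℕ)) : Set ℤ) ∧
      ∀ σ, |(gen q)^[k] f σ| ≤ 2 ^ k * n.ascFactorial k * C := by
  induction k with
  | zero => simpa using ⟨by simpa using hf, hC⟩
  | succ k ih =>
    rw [Function.iterate_succ_apply']
    refine ⟨dependsOn_gen q ih.1, fun σ => (abs_gen_le q ih.1 ih.2 σ).trans_eq ?_⟩
    rw [Nat.ascFactorial_succ]
    push_cast
    ring

/-- Local functions are analytic vectors of the generator. -/
theorem IsLocal.exists_iterate_bound {f : Config → ℝ} (hf : IsLocal f) (q : unitInterval) :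
    ∃ b : ℕ → ℝ, (∀ k σ, |(East.gen q)^[k] f σ| ≤ b k) ∧
      Summable fun k => (1 / 4 : ℝ) ^ k / k ! * b k := by
  obtain ⟨a, n, hn⟩ := hf.exists_dependsOn_Ico
  obtain ⟨C, hC⟩ := hf.exists_bound
  refine ⟨_, fun k => (abs_iterate_gen_le q hn hC k).2, ?_⟩
  -- The bound is `2^k k! (n+k choose k) C`, so the weight `(1/4)^k / k!` leaves a binomial
  -- coefficient times `(1/2)^k`.
  have h := (summable_choose_mul_geometric_of_norm_lt_one n (r := (1 / 2 : ℝ))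
    (by norm_num)).mul_right C
  refine h.congr fun k => ?_
  rw [Nat.ascFactorial_eq_factorial_mul_choose, ← Nat.choose_symm_add (a := n) (b := k), add_comm n k]
  have : (k ! : ℝ) ≠ 0 := by positivity
  push_cast
  field_simp
  rw [mul_assoc _ ((1 / 4 : ℝ) ^ k), ← mul_pow]
  norm_num
  ring

/-! ### Invariance of the product measure and the Dirichlet form. -/

/-- Resampling the spin at one site leaves the product measure invariant. -/
theorem eqLaw_map_update (q : unitInterval) (x : ℤ) :
    ((eqLaw q).prod (siteLaw q)).map (fun z => Function.update z.1 x z.2) = eqLaw q := by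
  have hm : Measurable fun z : Config × Bool => Function.update z.1 x z.2 := by
    refine measurable_pi_lambda _ fun i => ?_
    by_cases hi : i = x
    · subst hi; simpa using measurable_snd
    · simp only [Function.update_of_ne hi]; fun_prop
  refine Measure.eq_infinitePi _ fun s t ht => ?_
  rw [Measure.map_apply hm (MeasurableSet.pi s.countable_toSet fun i _ => ht i)]
  by_cases hx : x ∈ s
  · have : (fun z : Config × Bool => Function.update z.1 x z.2) ⁻¹' (Set.pi s t) =
        (Set.pi (s.erase x) t) ×ˢ (t x) := by
      ext z
      simp only [Set.mem_preimage, Set.mem_pi, Set.mem_prod, Finset.mem_coe, Finset.mem_erase]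
      constructor
      · intro h
        exact ⟨fun i hi => by simpa [Function.update_of_ne hi.1] using h i hi.2,
          by simpa using h x hx⟩
      · rintro ⟨h1, h2⟩ i hi
        by_cases hix : i = x
        · subst hix; simpa using h2
        · simpa [Function.update_of_ne hix] using h1 i ⟨hix, hi⟩
    rw [this, Measure.prod_prod, eqLaw, Measure.infinitePi_pi _ fun i _ => ht i,
      Finset.prod_erase_mul _ _ hx]
  · have : (fun z : Config × Bool => Function.update z.1 x z.2) ⁻¹' (Set.pi s t) =
        (Set.pi s t) ×ˢ Set.univ := by
      ext z
      simp only [Set.mem_preimage, Set.mem_pi, Set.mem_prod, Finset.mem_coe, Set.mem_univ, and_true]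
      refine forall₂_congr fun i hi => ?_
      rw [Function.update_of_ne (ne_of_mem_of_not_mem hi hx)]
    rw [this, Measure.prod_prod, eqLaw, Measure.infinitePi_pi _ fun i _ => ht i,
      measure_univ, mul_one]

instance (q : unitInterval) : IsProbabilityMeasure (eqLaw q) := by
  unfold eqLaw; infer_instance

theorem integral_siteMean (q : unitInterval) (x : ℤ) {f : Config → ℝ} (hf : IsLocal f) :
    ∫ σ, siteMean q x f σ ∂(eqLaw q) = ∫ σ, f σ ∂(eqLaw q) := by
  have hm : Measurable fun z : Config × Bool => Function.update z.1 x z.2 := by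
    refine measurable_pi_lambda _ fun i => ?_
    by_cases hi : i = x
    · subst hi; simpa using measurable_snd
    · simp only [Function.update_of_ne hi]; fun_prop
  conv_rhs => rw [← eqLaw_map_update q x,
    integral_map hm.aemeasurable hf.measurable.aestronglyMeasurable]
  obtain ⟨C, hC⟩ := hf.exists_bound
  rw [integral_prod (fun z : Config × Bool => f (Function.update z.1 x z.2)) (Integrable.of_bound (hf.measurable.comp hm).aestronglyMeasurable C
    (by simpa using ae_of_all _ fun z : Config × Bool => hC _))]
  rfl

theorem constraint_update (x : ℤ) (σ : Config) (b : Bool) :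
    constraint x (Function.update σ x b) = constraint x σ := by
  simp [constraint]

/-- Since `c_x` ignores the spin at `x`, averaging over that spin kills each term. -/
theorem integral_gen (q : unitInterval) {f : Config → ℝ} (hf : IsLocal f) :
    ∫ σ, gen q f σ ∂(eqLaw q) = 0 := by
  obtain ⟨S, hS⟩ := id hf
  have hl : ∀ x, IsLocal fun σ => constraint x σ * (siteMean q x f σ - f σ) := fun x =>
    (isLocal_constraint x).mul ((hf.siteMean q x).sub hf)
  simp_rw [gen_eq_sum q hS]
  rw [integral_finsetSum _ fun x _ => (hl x).integrable _]
  refine Finset.sum_eq_zero fun x _ => ?_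
  rw [← integral_siteMean q x (hl x)]
  refine integral_eq_zero_of_ae (ae_of_all _ fun σ => ?_)
  simp only [siteMean_eq, constraint_update, Function.update_idem, Pi.zero_apply]
  ring

/-- Averaging over the spin at `x` turns `f (π_x f - f)` into `-Var_x f`, while `c_x` factors out.
-/
theorem integral_mul_gen (q : unitInterval) {f : Config → ℝ} (hf : IsLocal f) :
    ∫ σ, f σ * gen q f σ ∂(eqLaw q) = -dirichlet q f := by
  obtain ⟨S, hS⟩ := id hf
  have hl : ∀ x, IsLocal fun σ => f σ * (constraint x σ * (siteMean q x f σ - f σ)) := fun x =>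
    hf.mul ((isLocal_constraint x).mul ((hf.siteMean q x).sub hf))
  rw [dirichlet, tsum_eq_sum (s := S) fun x hx => by
    simp [siteVar_of_notMem q hS (show x ∉ (S : Set ℤ) by simpa using hx)]]
  simp_rw [gen_eq_sum q hS, Finset.mul_sum]
  rw [integral_finsetSum _ fun x _ => (hl x).integrable _, ← Finset.sum_neg_distrib]
  refine Finset.sum_congr rfl fun x _ => ?_
  rw [← integral_siteMean q x (hl x), ← integral_neg]
  refine integral_congr_ae (ae_of_all _ fun σ => ?_)
  simp only [siteMean_eq, siteVar_eq, constraint_update, Function.update_idem]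
  ring

theorem dirichlet_nonneg (q : unitInterval) (f : Config → ℝ) : 0 ≤ dirichlet q f :=
  tsum_nonneg fun x => integral_nonneg fun σ =>
    mul_nonneg (constraint_nonneg x σ) (siteVar_nonneg q x f σ)

theorem gap_nonneg (q : unitInterval) : 0 ≤ gap q := by
  refine Real.sInf_nonneg ?_
  rintro r ⟨f, -, -, rfl⟩
  exact div_nonneg (dirichlet_nonneg q f) (variance_nonneg _ _)

theorem gap_mul_variance_le (q : unitInterval) {f : Config → ℝ} (hf : IsLocal f) :
    gap q * variance f (eqLaw q) ≤ dirichlet q f := by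
  by_cases hv : variance f (eqLaw q) = 0
  · rw [hv, mul_zero]; exact dirichlet_nonneg q f
  · rw [← le_div_iff₀ (lt_of_le_of_ne (variance_nonneg _ _) (Ne.symm hv))]
    refine csInf_le ⟨0, ?_⟩ ⟨f, hf, hv, rfl⟩
    rintro r ⟨g, -, -, rfl⟩
    exact div_nonneg (dirichlet_nonneg q g) (variance_nonneg _ _)

/-! ### Taylor polynomials of the semigroup and their decay in mean square. -/

/-- The Taylor polynomial `∑_{k ≤ n} t^k / k! L^k f` of the semigroup. -/
noncomputable def taylorGen (q : unitInterval) (f : Config → ℝ) (n : ℕ) (t : ℝ) (σ : Config) : ℝ :=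
  ∑ k ∈ Finset.range (n + 1), t ^ k / k ! * (gen q)^[k] f σ

theorem IsLocal.taylorGen {f : Config → ℝ} (hf : IsLocal f) (q : unitInterval) (n : ℕ) (t : ℝ) :
    IsLocal (taylorGen q f n t) :=
  IsLocal.sum _ fun k _ => (IsLocal.const _).mul (hf.iterate_gen q k)

theorem integral_taylorGen (q : unitInterval) {f : Config → ℝ} (hf : IsLocal f) (n : ℕ) (t : ℝ) :
    ∫ σ, taylorGen q f n t σ ∂(eqLaw q) = ∫ σ, f σ ∂(eqLaw q) := by
  unfold taylorGen
  rw [integral_finsetSum _ fun k _ => ((hf.iterate_gen q k).integrable _).const_mul _,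
    Finset.sum_range_succ', Finset.sum_eq_zero]
  · simp
  · intro k _
    rw [integral_const_mul, Function.iterate_succ_apply', integral_gen q (hf.iterate_gen q k),
      mul_zero]

theorem gen_taylorGen (q : unitInterval) {f : Config → ℝ} (hf : IsLocal f) (n : ℕ) (t : ℝ)
    (σ : Config) :
    gen q (taylorGen q f n t) σ =
      ∑ k ∈ Finset.range (n + 1), t ^ k / k ! * (gen q)^[k + 1] f σ := by
  simp_rw [Function.iterate_succ_apply']
  exact gen_sum_mul q _ (fun k => t ^ k / k !) (fun k => hf.iterate_gen q k) σ

theorem integral_sum_mul_sum {ι : Type*} (μ : Measure Config) [IsFiniteMeasure μ] (K : Finset ι)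
    (c d : ι → ℝ) {v : ι → Config → ℝ} (hv : ∀ k, IsLocal (v k)) :
    ∫ σ, (∑ k ∈ K, c k * v k σ) * (∑ j ∈ K, d j * v j σ) ∂μ =
      ∑ k ∈ K, ∑ j ∈ K, c k * d j * ∫ σ, v k σ * v j σ ∂μ := by
  simp_rw [Finset.sum_mul_sum, ← integral_const_mul]
  have hl : ∀ k j, IsLocal fun σ => c k * v k σ * (d j * v j σ) := fun k j =>
    ((IsLocal.const _).mul (hv k)).mul ((IsLocal.const _).mul (hv j))
  rw [integral_finsetSum _ fun k _ => (IsLocal.sum K fun j _ => hl k j).integrable _]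
  refine Finset.sum_congr rfl fun k _ => ?_
  rw [integral_finsetSum _ fun j _ => (hl k j).integrable _]
  refine Finset.sum_congr rfl fun j _ => integral_congr_ae (ae_of_all _ fun σ => ?_)
  ring

/-- Expanding the square leaves finitely many constant integrals with differentiable coefficients,
so no differentiation under the integral is needed. -/
theorem hasDerivAt_integral_sq_sum {ι : Type*} (μ : Measure Config) [IsFiniteMeasure μ]
    (K : Finset ι) {c c' : ι → ℝ → ℝ} {t : ℝ} (hc : ∀ k, HasDerivAt (c k) (c' k t) t)
    {v : ι → Config → ℝ} (hv : ∀ k, IsLocal (v k)) :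
    HasDerivAt (fun s => ∫ σ, (∑ k ∈ K, c k s * v k σ) ^ 2 ∂μ)
      (2 * ∫ σ, (∑ k ∈ K, c k t * v k σ) * (∑ k ∈ K, c' k t * v k σ) ∂μ) t := by
  simp_rw [sq, integral_sum_mul_sum μ K _ _ hv]
  have h : HasDerivAt (fun s => ∑ k ∈ K, ∑ j ∈ K, c k s * c j s * ∫ σ, v k σ * v j σ ∂μ)
      (∑ k ∈ K, ∑ j ∈ K, (c' k t * c j t + c k t * c' j t) * ∫ σ, v k σ * v j σ ∂μ) t :=
    HasDerivAt.fun_sum fun k _ => HasDerivAt.fun_sum fun j _ =>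
      ((hc k).mul (hc j)).mul_const _
  convert h using 1
  simp_rw [add_mul, Finset.sum_add_distrib]
  rw [Finset.sum_comm (f := fun k j => c' k t * c j t * ∫ σ, v k σ * v j σ ∂μ), two_mul]
  congr 1
  refine Finset.sum_congr rfl fun k _ => Finset.sum_congr rfl fun j _ => ?_
  rw [mul_comm (c' j t)]
  simp_rw [mul_comm (v k _)]

theorem hasDerivAt_taylor_coeff (k : ℕ) (t : ℝ) :
    HasDerivAt (fun t : ℝ => t ^ k / k !) (k * t ^ (k - 1) / k !) t :=
  (hasDerivAt_pow k t).div_const _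

/-- The Taylor polynomial solves the backward equation up to its top term, which is the error in the
energy estimate. -/
theorem sum_taylor_coeff_deriv (q : unitInterval) {f : Config → ℝ} (hf : IsLocal f) (n : ℕ) (t : ℝ)
    (σ : Config) :
    ∑ k ∈ Finset.range (n + 1), k * t ^ (k - 1) / k ! * (gen q)^[k] f σ =
      gen q (taylorGen q f n t) σ - t ^ n / n ! * (gen q)^[n + 1] f σ := by
  rw [gen_taylorGen q hf, Finset.sum_range_succ (fun k => t ^ k / k ! * (gen q)^[k + 1] f σ), add_sub_cancel_right, Finset.sum_range_succ']
  simp only [Nat.cast_zero, zero_mul, zero_div, add_zero]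
  refine Finset.sum_congr rfl fun k _ => ?_
  have h1 : (k ! : ℝ) ≠ 0 := by positivity
  have h2 : (k + 1 : ℝ) ≠ 0 := by positivity
  rw [Nat.factorial_succ, Nat.add_sub_cancel]
  push_cast
  field_simp

theorem variance_eq_of_isLocal (q : unitInterval) {f : Config → ℝ} (hf : IsLocal f) :
    variance f (eqLaw q) = ∫ σ, f σ ^ 2 ∂(eqLaw q) - (∫ σ, f σ ∂(eqLaw q)) ^ 2 :=
  variance_eq_sub (hf.memLp _)

/-- A form of Grönwall's inequality. -/
theorem le_add_exp_of_deriv_le {V V' : ℝ → ℝ} {g d T : ℝ} (hg : 0 ≤ g) (hd : 0 ≤ d)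
    (hV : ∀ t, HasDerivAt V (V' t) t) (h : ∀ t, 0 ≤ t → t ≤ T → V' t ≤ -g * V t + d)
    {t : ℝ} (ht : 0 ≤ t) (htT : t ≤ T) : V t ≤ Real.exp (-g * t) * V 0 + d * t := by
  have hW : ∀ s, HasDerivAt (fun s => Real.exp (g * s) * (V s - d * s))
      (Real.exp (g * s) * g * (V s - d * s) + Real.exp (g * s) * (V' s - d)) s := fun s => by
    have h1 : HasDerivAt (fun s => Real.exp (g * s)) (Real.exp (g * s) * g) s := by
      simpa using ((hasDerivAt_id s).const_mul g).exp
    have h2 : HasDerivAt (fun s => V s - d * s) (V' s - d) s := by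
      simpa using (hV s).fun_sub ((hasDerivAt_id s).const_mul d)
    exact h1.mul h2
  -- Subtracting `d * s` absorbs the error: the derivative is at most `-exp(g s) g d s`.
  have hanti : AntitoneOn (fun s => Real.exp (g * s) * (V s - d * s)) (Set.Icc 0 T) := by
    refine antitoneOn_of_deriv_nonpos (convex_Icc 0 T)
      (fun s _ => (hW s).continuousAt.continuousWithinAt)
      (fun s _ => (hW s).differentiableAt.differentiableWithinAt) fun s hs => ?_
    rw [interior_Icc] at hs
    rw [(hW s).deriv, mul_assoc, ← mul_add]
    refine mul_nonpos_of_nonneg_of_nonpos (Real.exp_pos _).le ?_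
    have := h s hs.1.le hs.2.le
    have : 0 ≤ g * (d * s) := by have := hs.1.le; positivity
    nlinarith
  have h1 := hanti ⟨le_rfl, ht.trans htT⟩ ⟨ht, htT⟩ ht
  simp only [mul_zero, Real.exp_zero, sub_zero, one_mul] at h1
  have h2 : Real.exp (-g * t) * Real.exp (g * t) = 1 := by rw [← Real.exp_add]; simp
  have h3 := mul_le_mul_of_nonneg_left h1 (Real.exp_pos (-g * t)).le
  rw [← mul_assoc, h2] at h3
  linarith

/-- The exponential decay of the variance along the Taylor polynomials of the semigroup. -/
theorem exists_integral_sq_taylorGen_le (q : unitInterval) {f : Config → ℝ} (hf : IsLocal f) :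
    ∃ e : ℕ → ℝ, Tendsto e atTop (𝓝 0) ∧ ∀ n t, 0 ≤ t → t ≤ 1 / 8 →
      ∫ σ, taylorGen q f n t σ ^ 2 ∂(eqLaw q) ≤ (∫ σ, f σ ∂(eqLaw q)) ^ 2 +
        Real.exp (-(2 * gap q) * t) *
          (∫ σ, f σ ^ 2 ∂(eqLaw q) - (∫ σ, f σ ∂(eqLaw q)) ^ 2) + e n := by
  obtain ⟨b, hb, hsum⟩ := hf.exists_iterate_bound q
  have hb0 : ∀ k, 0 ≤ b k := fun k => (abs_nonneg _).trans (hb k fun _ => true)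
  set a : ℕ → ℝ := fun k => (1 / 4 : ℝ) ^ k / k ! * b k with ha
  have ha0 : ∀ k, 0 ≤ a k := fun k => by have := hb0 k; positivity
  set B := ∑' k, a k
  have hB0 : 0 ≤ B := tsum_nonneg ha0
  have hu : ∀ n t σ, 0 ≤ t → t ≤ 1 / 8 → |taylorGen q f n t σ| ≤ B := by
    intro n t σ ht ht'
    refine (Finset.abs_sum_le_sum_abs _ _).trans ((Finset.sum_le_sum fun k _ => ?_).trans
      (hsum.sum_le_tsum _ fun k _ => ha0 k))
    rw [abs_mul, abs_of_nonneg (by positivity)]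
    refine mul_le_mul ?_ (hb k σ) (abs_nonneg _) (by positivity)
    gcongr
    linarith
  have hr : ∀ n t σ, 0 ≤ t → t ≤ 1 / 8 →
      |t ^ n / n ! * (gen q)^[n + 1] f σ| ≤ 8 * a (n + 1) := by
    intro n t σ ht ht'
    rw [abs_mul, abs_of_nonneg (by positivity)]
    have h1 : t ^ n / n ! * |(gen q)^[n + 1] f σ| ≤ (1 / 8) ^ n / n ! * b (n + 1) := by
      gcongr; exact hb _ σ
    refine h1.trans ?_
    -- Passing from `n!` to `(n+1)!` costs a factor `n + 1`, paid for by working at radius `1/8`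
    -- instead of `1/4`.
    have h2 : ((n : ℝ) + 1) ≤ 2 * 2 ^ n := by
      have : n + 1 ≤ 2 ^ (n + 1) := Nat.lt_two_pow_self.le
      have : ((n + 1 : ℕ) : ℝ) ≤ ((2 ^ (n + 1) : ℕ) : ℝ) := by exact_mod_cast this
      push_cast at this
      rw [pow_succ] at this
      linarith
    rw [ha]
    have h3 : (8 : ℝ) * ((1 / 4) ^ (n + 1) / (n + 1)! * b (n + 1)) =
        (1 / 8) ^ n / n ! * b (n + 1) * (2 * 2 ^ n / (n + 1)) := by
      have h1 : (n ! : ℝ) ≠ 0 := by positivity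
      have h2 : (n + 1 : ℝ) ≠ 0 := by positivity
      have h4 : (1 / 4 : ℝ) ^ n = (1 / 8) ^ n * 2 ^ n := by rw [← mul_pow]; norm_num
      rw [Nat.factorial_succ, pow_succ, h4]
      push_cast
      field_simp
      ring
    have h4 : 1 ≤ 2 * 2 ^ n / ((n : ℝ) + 1) := by rw [one_le_div (by positivity)]; exact h2
    rw [h3]
    exact le_mul_of_one_le_right (by have := hb0 (n + 1); positivity) h4
  refine ⟨fun n => 2 * (B * (8 * a (n + 1))), ?_, fun n t ht ht' => ?_⟩
  · have := ((hsum.tendsto_atTop_zero.comp (tendsto_add_atTop_nat 1)).const_mul 8).const_mul B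
    simpa using this.const_mul 2
  set m := ∫ σ, f σ ∂(eqLaw q)
  set V : ℝ → ℝ := fun s => ∫ σ, taylorGen q f n s σ ^ 2 ∂(eqLaw q) - m ^ 2
  have hV : ∀ s, HasDerivAt V (2 * ∫ σ, taylorGen q f n s σ *
      (∑ k ∈ Finset.range (n + 1), k * s ^ (k - 1) / k ! * (gen q)^[k] f σ) ∂(eqLaw q)) s :=
    fun s => (hasDerivAt_integral_sq_sum (eqLaw q) (Finset.range (n + 1))
      (c' := fun k s => k * s ^ (k - 1) / k !)
      (fun k => hasDerivAt_taylor_coeff k s) fun k => hf.iterate_gen q k).sub_const _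
  have hd : 0 ≤ 2 * (B * (8 * a (n + 1))) := by have := ha0 (n + 1); positivity
  have key := le_add_exp_of_deriv_le (T := 1 / 8) (mul_nonneg zero_le_two (gap_nonneg q)) hd hV
    (fun s hs hs' => ?_) ht ht'
  · have hV0 : V 0 = ∫ σ, f σ ^ 2 ∂(eqLaw q) - m ^ 2 := by
      have : ∀ σ, taylorGen q f n 0 σ = f σ := fun σ => by
        rw [taylorGen, Finset.sum_range_succ', Finset.sum_eq_zero] <;> simp
      simp [V, this]
    rw [hV0] at key
    have : 2 * (B * (8 * a (n + 1))) * t ≤ 2 * (B * (8 * a (n + 1))) :=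
      mul_le_of_le_one_right hd (by linarith)
    simp only [V] at key
    linarith
  · have hl := hf.taylorGen q n s
    simp_rw [sum_taylor_coeff_deriv q hf, mul_sub]
    rw [integral_sub ((hl.mul (hl.gen q)).integrable _)
      ((hl.mul ((IsLocal.const _).mul (hf.iterate_gen q _))).integrable _), integral_mul_gen q hl]
    -- The mean of the Taylor polynomial does not depend on time, so its variance is exactly `V s`.
    have h1 := gap_mul_variance_le q hl
    rw [variance_eq_of_isLocal q hl, integral_taylorGen q hf] at h1
    have h2 : |∫ σ, taylorGen q f n s σ * (s ^ n / n ! * (gen q)^[n + 1] f σ) ∂(eqLaw q)| ≤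
        B * (8 * a (n + 1)) := by
      have := norm_integral_le_of_norm_le_const (μ := eqLaw q) (C := B * (8 * a (n + 1)))
        (f := fun σ => taylorGen q f n s σ * (s ^ n / n ! * (gen q)^[n + 1] f σ))
        (ae_of_all _ fun σ => by
          rw [norm_mul]
          exact mul_le_mul (hu n s σ hs hs') (hr n s σ hs hs') (norm_nonneg _) hB0)
      simpa using this
    have h3 := (abs_le.1 h2).1
    simp only [V]
    nlinarith

/-! ### Measurability and integrability along paths. -/

namespace Path

theorem measurable_at (t : ℝ≥0) : Measurable fun ω : Path => ω.at_ t :=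
  Measurable.of_comap_le (le_iSup (fun t : ℝ≥0 =>
    MeasurableSpace.comap (fun ω : Path => ω.at_ t) inferInstance) t)

theorem measurable_at_canonicalFiltration {s t : ℝ≥0} (h : s ≤ t) :
    Measurable[canonicalFiltration t] fun ω : Path => ω.at_ s :=
  Measurable.of_comap_le (le_iSup₂ (f := fun (s : ℝ≥0) (_ : s ≤ t) =>
    MeasurableSpace.comap (fun ω : Path => ω.at_ s) inferInstance) s h)

/-- Right-continuous paths are jointly measurable in time and path. -/
theorem measurable_at_uncurry : Measurable fun z : ℝ≥0 × Path => z.2.at_ z.1 := by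
  -- Grid times just to the right of `u`: they take countably many values and tend to `u` from the
  -- side on which paths are continuous.
  let a : ℕ → ℝ≥0 → ℝ≥0 := fun n u => (⌊(n + 1) * u⌋₊ + 1) / (n + 1)
  refine measurable_of_tendsto_metrizable
    (f := fun (n : ℕ) (z : ℝ≥0 × Path) => z.2.at_ (a n z.1)) (fun n => ?_) ?_
  · have h : Measurable fun z : ℕ × Path => z.2.at_ ((z.1 + 1) / (n + 1)) :=
      measurable_from_prod_countable_right fun k => measurable_at ((k + 1) / (n + 1))
    have hfl : Measurable fun z : ℝ≥0 × Path => ((⌊(n + 1) * z.1⌋₊, z.2) : ℕ × Path) :=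
      (Nat.measurable_floor.comp (measurable_fst.const_mul _)).prodMk measurable_snd
    exact h.comp hfl
  · rw [tendsto_pi_nhds]
    rintro ⟨u, ω⟩
    have hlow : ∀ n, u ≤ a n u := fun n => by
      rw [le_div_iff₀ (by positivity), mul_comm]
      exact (Nat.lt_floor_add_one _).le
    have hup : ∀ n, a n u ≤ u + 1 / (n + 1) := fun n => by
      rw [div_le_iff₀ (by positivity), add_mul u, div_mul_cancel₀ _ (by positivity), mul_comm u]
      gcongr
      exact Nat.floor_le (by positivity)
    have hlim : Tendsto (fun n => a n u) atTop (𝓝[≥] u) := by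
      refine tendsto_nhdsWithin_iff.2 ⟨?_, Eventually.of_forall hlow⟩
      refine tendsto_of_tendsto_of_tendsto_of_le_of_le tendsto_const_nhds ?_ hlow hup
      have : Tendsto (fun n : ℕ => 1 / ((n : ℝ≥0) + 1)) atTop (𝓝 0) :=
        tendsto_one_div_add_atTop_nhds_zero_nat
      simpa using tendsto_const_nhds.add this
    exact (ω.2 u).1.tendsto.comp hlim

end Path

theorem IsLocal.measurable_path {f : Config → ℝ} (hf : IsLocal f) (s : ℝ≥0) :
    Measurable fun z : ℝ × Path => f (z.2.at_ (s + z.1.toNNReal)) :=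
  hf.measurable.comp (Path.measurable_at_uncurry.comp
    (((measurable_real_toNNReal.comp measurable_fst).const_add s).prodMk measurable_snd))

theorem IsLocal.integrable_path {f : Config → ℝ} (hf : IsLocal f) (t : ℝ≥0) (μ : Measure Path)
    [IsFiniteMeasure μ] : Integrable (fun ω : Path => f (ω.at_ t)) μ := by
  obtain ⟨C, hC⟩ := hf.exists_bound
  exact Integrable.of_bound (hf.measurable.comp (Path.measurable_at t)).aestronglyMeasurable C
    (by simpa using ae_of_all _ fun ω : Path => hC _)

theorem IsLocal.intervalIntegrable_path {f : Config → ℝ} (hf : IsLocal f) (s : ℝ≥0) (ω : Path)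
    (a b : ℝ) : IntervalIntegrable (fun u : ℝ => f (ω.at_ (s + u.toNNReal))) volume a b := by
  obtain ⟨C, hC⟩ := hf.exists_bound
  exact (intervalIntegrable_const (c := C)).mono_fun
    ((hf.measurable_path s).comp measurable_prodMk_right).aestronglyMeasurable
    (ae_of_all _ fun u => (hC _).trans (le_abs_self C))

theorem IsLocal.integrable_path_prod {f : Config → ℝ} (hf : IsLocal f) (s : ℝ≥0)
    (ν : Measure ℝ) [IsFiniteMeasure ν] (μ : Measure Path) [IsFiniteMeasure μ] :
    Integrable (fun z : ℝ × Path => f (z.2.at_ (s + z.1.toNNReal))) (ν.prod μ) := by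
  obtain ⟨C, hC⟩ := hf.exists_bound
  exact Integrable.of_bound (hf.measurable_path s).aestronglyMeasurable C
    (by simpa using ae_of_all _ fun z : ℝ × Path => hC _)

theorem IsLocal.integrable_intervalIntegral_path {f : Config → ℝ} (hf : IsLocal f) (s : ℝ≥0)
    (t : ℝ≥0) (μ : Measure Path) [IsFiniteMeasure μ] :
    Integrable (fun ω : Path => ∫ u in (0 : ℝ)..t, f (ω.at_ (s + u.toNNReal))) μ := by
  simp_rw [intervalIntegral.integral_of_le t.coe_nonneg]
  exact (hf.integrable_path_prod s _ μ).integral_prod_right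

/-! ### From the martingale problem to the Markov property. -/

/-- The stationary law of the process on path space. -/
noncomputable def pathLaw (q : unitInterval) (P : Kernel Config Path) : Measure Path :=
  P ∘ₘ eqLaw q

section

variable {q : unitInterval} {P : Kernel Config Path}

theorem setIntegral_pathLaw {f : Path → ℝ} {G : Set Path} (hG : MeasurableSet G)
    (hf : IntegrableOn f G (pathLaw q P)) :
    ∫ ω in G, f ω ∂(pathLaw q P) = ∫ η, ∫ ω in G, f ω ∂(P η) ∂(eqLaw q) := by
  rw [pathLaw, Measure.comp_eq_comp_const_apply] at hf ⊢
  exact Kernel.setIntegral_comp hG hf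

theorem IsEastProcess.isProbabilityMeasure (hP : IsEastProcess q P) :
    IsProbabilityMeasure (pathLaw q P) := by
  have := hP.isMarkovKernel
  unfold pathLaw; infer_instance

theorem IsEastProcess.setIntegral_increment_eq_zero (hP : IsEastProcess q P) {f : Config → ℝ}
    (hf : IsLocal f) (s t : ℝ≥0) {G : Set Path}
    (hG : MeasurableSet[Path.canonicalFiltration s] G) (η : Config) :
    ∫ ω in G, (f (ω.at_ (s + t)) - f (ω.at_ s) -
      ∫ u in (0 : ℝ)..t, gen q f (ω.at_ (s + u.toNNReal))) ∂(P η) = 0 := by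
  have := hP.isMarkovKernel
  have hm := hP.martingale η f hf
  have h := hm.setIntegral_eq (le_add_of_nonneg_right (zero_le : 0 ≤ t)) hG
  rw [eq_comm, ← sub_eq_zero, ← integral_sub (hm.integrable _).integrableOn
    (hm.integrable _).integrableOn] at h
  refine Eq.trans ?_ h
  refine integral_congr_ae (ae_of_all _ fun ω => ?_)
  have hi : ∀ a b : ℝ, IntervalIntegrable (fun u : ℝ => gen q f (ω.at_ u.toNNReal)) volume a b :=
    fun a b => by simpa using (hf.gen q).intervalIntegrable_path 0 ω a b
  have h1 : ∫ u in (0 : ℝ)..t, gen q f (ω.at_ (s + u.toNNReal)) =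
      ∫ u in (s : ℝ)..(s + t : ℝ≥0), gen q f (ω.at_ u.toNNReal) := by
    have := intervalIntegral.integral_comp_add_left (a := (0 : ℝ)) (b := t)
      (fun u : ℝ => gen q f (ω.at_ u.toNNReal)) (s : ℝ)
    simp only [add_zero] at this
    rw [NNReal.coe_add, ← this]
    refine intervalIntegral.integral_congr fun u hu => ?_
    rw [Set.uIcc_of_le t.coe_nonneg] at hu
    rw [Real.toNNReal_add s.coe_nonneg hu.1, Real.toNNReal_coe]
  have h2 := intervalIntegral.integral_interval_sub_left (hi 0 (s + t : ℝ≥0)) (hi 0 s)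
  beta_reduce
  rw [h1, ← h2]
  ring

/-- This is the integrated forward equation on an event of the past: average the martingale identity
over the starting point and apply Fubini. -/
theorem IsEastProcess.setIntegral_sub (hP : IsEastProcess q P) {f : Config → ℝ}
    (hf : IsLocal f) (s t : ℝ≥0) {G : Set Path}
    (hG : MeasurableSet[Path.canonicalFiltration s] G) :
    ∫ ω in G, f (ω.at_ (s + t)) ∂(pathLaw q P) - ∫ ω in G, f (ω.at_ s) ∂(pathLaw q P) =
      ∫ u in (0 : ℝ)..t, ∫ ω in G, gen q f (ω.at_ (s + u.toNNReal)) ∂(pathLaw q P) := by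
  have := hP.isMarkovKernel
  have := hP.isProbabilityMeasure
  have hi1 := hf.integrable_path (s + t) ((pathLaw q P).restrict G)
  have hi2 := hf.integrable_path s ((pathLaw q P).restrict G)
  have hi3 := (hf.gen q).integrable_intervalIntegral_path s t ((pathLaw q P).restrict G)
  have : IsFiniteMeasure (volume.restrict (Set.uIoc (0 : ℝ) t)) :=
    ⟨by simp⟩
  rw [intervalIntegral_integral_swap ((hf.gen q).integrable_path_prod s _ _),
    ← sub_eq_zero, ← integral_sub hi1 hi2]
  refine (integral_sub (hi1.sub hi2) hi3).symm.trans ?_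
  have h := setIntegral_pathLaw
    (Path.canonicalFiltration.le s G hG) ((hi1.sub hi2).sub hi3)
  refine h.trans ?_
  exact integral_eq_zero_of_ae (ae_of_all _ fun η => hP.setIntegral_increment_eq_zero hf s t hG η)

theorem IsEastProcess.integral_at_zero (hP : IsEastProcess q P) {f : Config → ℝ}
    (hf : IsLocal f) : ∫ ω, f (ω.at_ 0) ∂(pathLaw q P) = ∫ σ, f σ ∂(eqLaw q) := by
  have := hP.isMarkovKernel
  have := hP.isProbabilityMeasure
  have h := setIntegral_pathLaw MeasurableSet.univ
    (hf.integrable_path 0 (pathLaw q P)).integrableOn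
  simp only [Measure.restrict_univ] at h
  refine h.trans (integral_congr_ae (ae_of_all _ fun η => ?_))
  beta_reduce
  rw [integral_congr_ae ((hP.initial η).mono fun ω h => by rw [h] : _ =ᵐ[P η] fun _ => f η)]
  simp

/-- Taylor's formula for a sequence of functions each of which is a primitive of the next one. -/
theorem abs_sub_taylor_le {M : ℕ → ℝ → ℝ} {b : ℕ → ℝ}
    (hM : ∀ k t, 0 ≤ t → M k t - M k 0 = ∫ u in (0 : ℝ)..t, M (k + 1) u)
    (hi : ∀ k t, 0 ≤ t → IntervalIntegrable (M k) volume 0 t)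
    (hb : ∀ k t, |M k t| ≤ b k) (n : ℕ) : ∀ k t, 0 ≤ t →
      |M k t - ∑ j ∈ Finset.range n, t ^ j / j ! * M (k + j) 0| ≤ t ^ n / n ! * b (k + n) := by
  induction n with
  | zero => intro k t _; simpa using hb k t
  | succ n ih =>
    intro k t ht
    have hpoly : IntervalIntegrable
        (fun u => ∑ j ∈ Finset.range n, u ^ j / j ! * M (k + 1 + j) 0) volume 0 t :=
      Continuous.intervalIntegrable (by fun_prop) _ _
    have h1 : M k t - ∑ j ∈ Finset.range (n + 1), t ^ j / j ! * M (k + j) 0 =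
        ∫ u in (0 : ℝ)..t,
          (M (k + 1) u - ∑ j ∈ Finset.range n, u ^ j / j ! * M (k + 1 + j) 0) := by
      rw [intervalIntegral.integral_sub (hi _ t ht) hpoly, ← hM k t ht, Finset.sum_range_succ',
        intervalIntegral.integral_finsetSum fun j _ =>
          Continuous.intervalIntegrable (by fun_prop) _ _]
      have : ∀ j ∈ Finset.range n, ∫ u in (0 : ℝ)..t, u ^ j / j ! * M (k + 1 + j) 0 =
          t ^ (j + 1) / (j + 1)! * M (k + (j + 1)) 0 := fun j _ => by
        rw [intervalIntegral.integral_mul_const, intervalIntegral.integral_div, integral_pow,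
          Nat.factorial_succ, show k + 1 + j = k + (j + 1) by ring]
        have h1 : (j ! : ℝ) ≠ 0 := by positivity
        have h2 : (j + 1 : ℝ) ≠ 0 := by positivity
        push_cast
        field_simp
        simp
      rw [Finset.sum_congr rfl this]
      simp
      ring
    have h2 : ∫ u in (0 : ℝ)..t, u ^ n / n ! * b (k + 1 + n) =
        t ^ (n + 1) / (n + 1)! * b (k + (n + 1)) := by
      rw [intervalIntegral.integral_mul_const, intervalIntegral.integral_div, integral_pow,
          Nat.factorial_succ, show k + 1 + n = k + (n + 1) by ring]
      have h1 : (n ! : ℝ) ≠ 0 := by positivity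
      have h2 : (n + 1 : ℝ) ≠ 0 := by positivity
      push_cast
      field_simp
      simp
    rw [h1, ← h2]
    exact intervalIntegral.norm_integral_le_of_norm_le (g := fun u => u ^ n / n ! * b (k + 1 + n)) ht
      (ae_of_all _ fun u hu => (Real.norm_eq_abs _).trans_le (ih (k + 1) u hu.1.le))
      (Continuous.intervalIntegrable (by fun_prop) _ _)

/-- The Markov property for local functions and small times, with the semigroup given by its
Taylor polynomials. -/
theorem IsEastProcess.tendsto_setIntegral_taylorGen (hP : IsEastProcess q P) {f : Config → ℝ}
    (hf : IsLocal f) (s : ℝ≥0) {h : ℝ≥0} (hh : (h : ℝ) ≤ 1 / 8) {G : Set Path}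
    (hG : MeasurableSet[Path.canonicalFiltration s] G) :
    Tendsto (fun n => ∫ ω in G, taylorGen q f n h (ω.at_ s) ∂(pathLaw q P)) atTop
      (𝓝 (∫ ω in G, f (ω.at_ (s + h)) ∂(pathLaw q P))) := by
  have := hP.isProbabilityMeasure
  obtain ⟨b, hb, hsum⟩ := hf.exists_iterate_bound q
  have hb0 : ∀ k, 0 ≤ b k := fun k => (abs_nonneg _).trans (hb k fun _ => true)
  -- By the forward equation, each `M k` is a primitive of `M (k + 1)`, so `M 0` has a Taylor
  -- expansion in `u`.
  set M : ℕ → ℝ → ℝ := fun k u =>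
    ∫ ω in G, (gen q)^[k] f (ω.at_ (s + u.toNNReal)) ∂(pathLaw q P) with hMdef
  have hbM : ∀ k t, |M k t| ≤ b k := fun k t => by
    refine (norm_setIntegral_le_of_norm_le_const (measure_lt_top _ _)
      fun (ω : Path) _ => (Real.norm_eq_abs _).trans_le (hb k (ω.at_ (s + t.toNNReal)))).trans ?_
    exact mul_le_of_le_one_right (hb0 k) measureReal_le_one
  have hMi : ∀ k t, 0 ≤ t → IntervalIntegrable (M k) volume 0 t := fun k t _ => by
    refine (intervalIntegrable_const (c := b k)).mono_fun ?_
      (ae_of_all _ fun u => (hbM k u).trans (le_abs_self _))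
    exact ((hf.iterate_gen q k).measurable_path s).stronglyMeasurable.integral_prod_right'
      |>.aestronglyMeasurable
  have hM : ∀ k t, 0 ≤ t → M k t - M k 0 = ∫ u in (0 : ℝ)..t, M (k + 1) u := fun k t ht => by
    lift t to ℝ≥0 using ht
    have := hP.setIntegral_sub (hf.iterate_gen q k) s t hG
    simpa [hMdef, Function.iterate_succ_apply'] using this
  rw [tendsto_iff_norm_sub_tendsto_zero]
  refine squeeze_zero (fun _ => norm_nonneg _) (fun n => ?_)
    (hsum.tendsto_atTop_zero.comp (tendsto_add_atTop_nat 1))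
  have key := abs_sub_taylor_le hM hMi hbM (n + 1) 0 h h.2
  have h1 : ∫ ω in G, taylorGen q f n h (ω.at_ s) ∂(pathLaw q P) =
      ∑ j ∈ Finset.range (n + 1), (h : ℝ) ^ j / j ! * M (0 + j) 0 := by
    unfold taylorGen
    rw [integral_finsetSum _ fun k _ => ((hf.iterate_gen q k).integrable_path s _).const_mul _]
    simp [hMdef, integral_const_mul]
  rw [h1, norm_sub_rev]
  have h2 : M 0 h = ∫ ω in G, f (ω.at_ (s + h)) ∂(pathLaw q P) := by simp [hMdef]
  rw [← h2]
  refine key.trans ?_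
  simp only [Function.comp, zero_add]
  have := hb0 (n + 1)
  gcongr
  linarith

end

/-! ### Functions supported on one value of the origin. -/

/-- The indicator of the event that the spin at the origin is `b`. -/
def originInd (b : Bool) (σ : Config) : ℝ := if σ 0 = b then 1 else 0

theorem isLocal_originInd (b : Bool) : IsLocal (originInd b) :=
  ⟨{0}, fun σ τ h => by simp [originInd, h 0 (by simp)]⟩

theorem originInd_mul_self (b : Bool) (σ : Config) :
    originInd b σ * originInd b σ = originInd b σ := by
  unfold originInd; split_ifs <;> norm_num

theorem integral_originInd_le (q : unitInterval) (b : Bool) :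
    ∫ σ, originInd b σ ∂(eqLaw q) ≤ 1 - min (1 - (q : ℝ)) q := by
  rw [← integral_siteMean q 0 (isLocal_originInd b)]
  have h : ∀ σ, siteMean q 0 (originInd b) σ = if b then 1 - (q : ℝ) else q := fun σ => by
    rw [siteMean_eq]; cases b <;> simp [originInd]
  simp_rw [h, integral_const, probReal_univ, one_smul]
  have h1 := min_le_left (1 - (q : ℝ)) q
  have h2 := min_le_right (1 - (q : ℝ)) q
  split_ifs <;> linarith

/-- A Cauchy-Schwarz inequality for functions that vanish off an event of the spin at the origin. -/
theorem sq_integral_le_of_mul_originInd (q : unitInterval) {b : Bool} {g : Config → ℝ}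
    (hg : IsLocal g) (hgb : ∀ σ, g σ * originInd b σ = g σ) :
    (∫ σ, g σ ∂(eqLaw q)) ^ 2 ≤
      (1 - min (1 - (q : ℝ)) q) * ∫ σ, g σ ^ 2 ∂(eqLaw q) := by
  have hp := integral_originInd_le q b
  set m := ∫ σ, g σ ∂(eqLaw q)
  set a := 1 - min (1 - (q : ℝ)) q
  have ha : 0 < a := by
    have h1 := min_le_left (1 - (q : ℝ)) q
    have h2 := min_le_right (1 - (q : ℝ)) q
    simp only [a]; linarith
  have hi := isLocal_originInd b
  -- Cauchy-Schwarz by a nonnegative square, with the indicator's mean bounded by `a`.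
  have h0 : 0 ≤ ∫ σ, (a * g σ - m * originInd b σ) ^ 2 ∂(eqLaw q) :=
    integral_nonneg fun σ => sq_nonneg _
  have h1 : ∀ σ, (a * g σ - m * originInd b σ) ^ 2 =
      a ^ 2 * g σ ^ 2 - 2 * a * m * g σ + m ^ 2 * originInd b σ := fun σ => by
    have h2 := hgb σ
    have h3 := originInd_mul_self b σ
    linear_combination (-2 * a * m) * h2 + m ^ 2 * h3
  have hg2 : Integrable (fun σ => a ^ 2 * g σ ^ 2) (eqLaw q) := by
    simpa only [sq] using ((hg.mul hg).integrable (eqLaw q)).const_mul (a * a)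
  have hg1 : Integrable (fun σ => 2 * a * m * g σ) (eqLaw q) := (hg.integrable _).const_mul _
  simp_rw [h1] at h0
  have h2 := hg2.sub hg1
  rw [integral_add (by exact h2) ((hi.integrable _).const_mul _), integral_sub hg2 hg1,
    integral_const_mul, integral_const_mul, integral_const_mul] at h0
  have h4 : m ^ 2 * ∫ σ, originInd b σ ∂(eqLaw q) ≤ m ^ 2 * a := by gcongr
  have h5 : a * m ^ 2 ≤ a * (a * ∫ σ, g σ ^ 2 ∂(eqLaw q)) := by
    change 0 ≤ a ^ 2 * _ - 2 * a * m * m + _ at h0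
    nlinarith
  exact le_of_mul_le_mul_left h5 ha

/-! ### Staying at one value along a time grid. -/

/-- The event that the spin at the origin is `b` at the times `0, h, …, n h`. -/
def stayEvent (b : Bool) (h : ℝ≥0) (n : ℕ) : Set Path :=
  {ω | ∀ j ≤ n, ω.at_ (j * h) 0 = b}

theorem measurableSet_stayEvent (b : Bool) (h : ℝ≥0) (n : ℕ) :
    MeasurableSet[Path.canonicalFiltration (n * h)] (stayEvent b h n) := by
  have : stayEvent b h n = ⋂ j : ℕ, ⋂ _ : j ≤ n, (fun ω : Path => ω.at_ (j * h)) ⁻¹'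
      {σ | σ 0 = b} := by
    ext ω; simp [stayEvent]
  rw [this]
  refine MeasurableSet.iInter fun j => MeasurableSet.iInter fun hj => ?_
  exact Path.measurable_at_canonicalFiltration (by gcongr)
    ((measurable_pi_apply (0 : ℤ) : Measurable fun σ : Config => σ 0) (measurableSet_singleton b))

theorem setIntegral_stayEvent_zero (μ : Measure Path) (b : Bool) (h : ℝ≥0) (f : Config → ℝ) :
    ∫ ω in stayEvent b h 0, f (ω.at_ 0) ∂μ = ∫ ω, f (ω.at_ 0) * originInd b (ω.at_ 0) ∂μ := by
  rw [← integral_indicator (Path.canonicalFiltration.le _ _ (measurableSet_stayEvent b h 0))]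
  refine integral_congr_ae (ae_of_all _ fun ω => ?_)
  by_cases hω : ω.at_ 0 0 = b <;> simp [Set.indicator, stayEvent, originInd, hω]

theorem setIntegral_stayEvent_succ (μ : Measure Path) (b : Bool) (h : ℝ≥0) (n : ℕ)
    (f : Config → ℝ) :
    ∫ ω in stayEvent b h (n + 1), f (ω.at_ ((n + 1 : ℕ) * h)) ∂μ =
      ∫ ω in stayEvent b h n, f (ω.at_ (n * h + h)) * originInd b (ω.at_ (n * h + h)) ∂μ := by
  rw [← integral_indicator (Path.canonicalFiltration.le _ _ (measurableSet_stayEvent b h _)),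
    ← integral_indicator (Path.canonicalFiltration.le _ _ (measurableSet_stayEvent b h _))]
  refine integral_congr_ae (ae_of_all _ fun ω => ?_)
  have h1 : ((n + 1 : ℕ) : ℝ≥0) * h = n * h + h := by push_cast; ring
  have h2 : ω ∈ stayEvent b h (n + 1) ↔ ω ∈ stayEvent b h n ∧ ω.at_ (n * h + h) 0 = b := by
    rw [← h1]
    constructor
    · exact fun hω => ⟨fun j hj => hω j (by omega), hω _ le_rfl⟩
    · rintro ⟨h3, h4⟩ j hj
      rcases Nat.lt_or_ge n j with hj' | hj'
      · obtain rfl : j = n + 1 := by omega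
        exact h4
      · exact h3 j hj'
  rw [h1]
  by_cases h3 : ω ∈ stayEvent b h n <;> by_cases h4 : ω.at_ (n * h + h) 0 = b <;>
    simp [Set.indicator, h2, h3, h4, originInd]

variable {q : unitInterval} {P : Kernel Config Path}

/-- Each step multiplies by the indicator and then applies the semigroup, contracting the norm by
`√r`. Allowing every local `f` lets the induction hypothesis be applied to Taylor polynomials. -/
theorem IsEastProcess.abs_setIntegral_stayEvent_le (hP : IsEastProcess q P) (b : Bool) {h : ℝ≥0}
    (hh : (h : ℝ) ≤ 1 / 8) (n : ℕ) {f : Config → ℝ} (hf : IsLocal f) :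
    |∫ ω in stayEvent b h n, f (ω.at_ (n * h)) ∂(pathLaw q P)| ≤
      √(1 - min (1 - (q : ℝ)) q * (1 - Real.exp (-(2 * gap q) * h))) ^ n *
        √(∫ σ, f σ ^ 2 ∂(eqLaw q)) := by
  set κ := min (1 - (q : ℝ)) q with hκ
  have hκ0 : 0 ≤ κ := le_min (by linarith [q.2.2]) q.2.1
  have hκ1 : κ ≤ 1 := (min_le_right _ _).trans q.2.2
  set E := Real.exp (-(2 * gap q) * h) with hE
  have hE0 : 0 ≤ E := (Real.exp_pos _).le
  have hE1 : E ≤ 1 := Real.exp_le_one_iff.2 (by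
    nlinarith [mul_nonneg (gap_nonneg q) h.coe_nonneg])
  have hi := isLocal_originInd b
  have hmul_le : ∀ f : Config → ℝ, IsLocal f →
      ∫ σ, (f σ * originInd b σ) ^ 2 ∂(eqLaw q) ≤ ∫ σ, f σ ^ 2 ∂(eqLaw q) := fun f hf => by
    refine integral_mono ?_ ?_ fun σ => ?_
    · exact ((hf.mul hi).map₂ hf fun x _ => x ^ 2).integrable _
    · exact (hf.map₂ hf fun x _ => x ^ 2).integrable _
    · beta_reduce
      unfold originInd
      split_ifs
      · simp
      · simpa using sq_nonneg (f σ)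
  induction n generalizing f with
  | zero =>
    simp only [Nat.cast_zero, zero_mul, pow_zero, one_mul]
    rw [setIntegral_stayEvent_zero, hP.integral_at_zero (hf.mul hi)]
    refine Real.abs_le_sqrt ?_
    refine (sq_integral_le_of_mul_originInd q (hf.mul hi) fun σ => by
      rw [mul_assoc, originInd_mul_self]).trans ?_
    refine (mul_le_of_le_one_left (integral_nonneg fun σ => sq_nonneg _) ?_).trans (hmul_le f hf)
    linarith
  | succ n ih =>
    set g : Config → ℝ := fun σ => f σ * originInd b σ with hg
    have hgl : IsLocal g := hf.mul hi
    rw [setIntegral_stayEvent_succ]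
    have hlim := (hP.tendsto_setIntegral_taylorGen hgl (n * h) hh
      (measurableSet_stayEvent b h n)).abs
    obtain ⟨e, he, hle⟩ := exists_integral_sq_taylorGen_le q hgl
    set m := ∫ σ, g σ ∂(eqLaw q)
    set S := ∫ σ, g σ ^ 2 ∂(eqLaw q)
    set r := 1 - κ * (1 - E) with hr
    have hlim2 : Tendsto (fun N => √r ^ n * √(m ^ 2 + E * (S - m ^ 2) + e N)) atTop
        (𝓝 (√r ^ n * √(m ^ 2 + E * (S - m ^ 2)))) := by
      have h1 : Tendsto (fun N => m ^ 2 + E * (S - m ^ 2) + e N) atTop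
          (𝓝 (m ^ 2 + E * (S - m ^ 2))) := by
        simpa using he.const_add (m ^ 2 + E * (S - m ^ 2))
      exact h1.sqrt.const_mul _
    have hbd : |∫ ω in stayEvent b h n, g (ω.at_ (n * h + h)) ∂(pathLaw q P)| ≤
        √r ^ n * √(m ^ 2 + E * (S - m ^ 2)) :=
      le_of_tendsto_of_tendsto' hlim hlim2 fun N => (ih (hgl.taylorGen q N h)).trans (by
        gcongr
        exact hle N h h.coe_nonneg hh)
    refine hbd.trans ?_
    rw [pow_succ (√r), mul_assoc, ← Real.sqrt_mul' _ (integral_nonneg fun σ => sq_nonneg _)]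
    gcongr
    have h1 : m ^ 2 ≤ (1 - κ) * S := sq_integral_le_of_mul_originInd q hgl fun σ => by
      simp only [hg]; rw [mul_assoc, originInd_mul_self]
    have h2 : S ≤ ∫ σ, f σ ^ 2 ∂(eqLaw q) := hmul_le f hf
    have hr0 : 0 ≤ r := by nlinarith
    -- The left side is `(1 - E) m² + E S`; inserting `m² ≤ (1 - κ) S` gives exactly `r S`.
    calc m ^ 2 + E * (S - m ^ 2) ≤ r * S := by nlinarith
      _ ≤ r * ∫ σ, f σ ^ 2 ∂(eqLaw q) := by gcongr

/-- On `[0, 1]`, `exp(-x) ≤ 1 / (1 + x) ≤ 1 - x / 2`; then `1 - y ≤ exp(-y)` with `y = κ x / 2`. -/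
theorem one_sub_mul_one_sub_exp_le {κ x : ℝ} (hκ : 0 ≤ κ) (hx : 0 ≤ x) (hx1 : x ≤ 1) :
    1 - κ * (1 - Real.exp (-x)) ≤ Real.exp (-(κ * x / 2)) := by
  have h1 : x / 2 ≤ 1 - Real.exp (-x) := by
    have h2 : Real.exp (-x) ≤ 1 - x / 2 := by
      have h3 := Real.add_one_le_exp x
      have h4 : Real.exp (-x) * Real.exp x = 1 := by rw [← Real.exp_add]; simp
      have h5 := Real.exp_pos (-x)
      nlinarith
    linarith
  have h2 := Real.add_one_le_exp (-(κ * x / 2))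
  nlinarith

theorem IsEastProcess.integral_stayEvent_le (hP : IsEastProcess q P) (b : Bool) {h : ℝ≥0}
    (hh : (h : ℝ) ≤ 1 / 8) (hh' : 2 * gap q * h ≤ 1) (n : ℕ) :
    ∫ η, (P η).real (stayEvent b h n) ∂(eqLaw q) ≤
      Real.exp (-(gap q * min (1 - (q : ℝ)) q / 4) * (n * h)) := by
  have := hP.isMarkovKernel
  have := hP.isProbabilityMeasure
  have hκ0 : 0 ≤ min (1 - (q : ℝ)) q := le_min (by linarith [q.2.2]) q.2.1
  have hx : 0 ≤ 2 * gap q * h :=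
    mul_nonneg (mul_nonneg zero_le_two (gap_nonneg q)) h.coe_nonneg
  have h1 := hP.abs_setIntegral_stayEvent_le b hh n (IsLocal.const 1)
  have h2 := setIntegral_pathLaw (q := q) (P := P) (f := fun _ => (1 : ℝ))
    (Path.canonicalFiltration.le _ _ (measurableSet_stayEvent b h n)) (integrable_const _)
  rw [h2] at h1
  simp only [integral_const, smul_eq_mul, mul_one, measureReal_restrict_apply_univ, one_pow,
    probReal_univ, Real.sqrt_one] at h1
  refine (le_abs_self _).trans (h1.trans ?_)
  have h3 := one_sub_mul_one_sub_exp_le hκ0 hx hh'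
  calc _ ≤ √(Real.exp (-(min (1 - (q : ℝ)) q * (2 * gap q * h) / 2))) ^ n := by
        rw [neg_mul]
        gcongr
    _ = Real.exp (-(gap q * min (1 - (q : ℝ)) q / 2) * (n * h)) := by
        rw [← Real.exp_half, ← Real.exp_nat_mul]
        congr 1
        ring
    _ ≤ _ := by
        refine Real.exp_le_exp.2 (mul_le_mul_of_nonneg_right ?_ (by positivity))
        have := mul_nonneg (gap_nonneg q) hκ0
        linarith

end East

/-! ### The persistence bound. -/

theorem mainTheorem7 (q : unitInterval) (P : Kernel East.Config East.Path)
    (hP : East.IsEastProcess q P) (t : ℝ≥0) :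
    East.persistence q P t ≤
      2 * Real.exp (-(East.gap q * min (1 - (q : ℝ)) (q : ℝ) / 4) * (t : ℝ)) := by
  have := hP.isMarkovKernel
  -- The three lower bounds on `n` give `h ≤ 1/8` for the Taylor series, `2 gap h ≤ 1` for the
  -- exponential inequality, and `n ≠ 0`.
  obtain ⟨n, hn⟩ := exists_nat_ge (max (8 * (t : ℝ)) (max (2 * East.gap q * t) 1))
  have hn1 : 8 * (t : ℝ) ≤ n := (le_max_left _ _).trans hn
  have hn2 : 2 * East.gap q * t ≤ n := (le_max_left _ _).trans ((le_max_right _ _).trans hn)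
  have hn0 : (0 : ℝ) < n :=
    zero_lt_one.trans_le ((le_max_right _ _).trans ((le_max_right _ _).trans hn))
  have hn0' : (n : ℝ≥0) ≠ 0 := by exact_mod_cast hn0.ne'
  set h : ℝ≥0 := t / n with hdef
  have hnh : (n : ℝ≥0) * h = t := mul_div_cancel₀ t hn0'
  have hnh' : (n : ℝ) * h = t := by exact_mod_cast congrArg NNReal.toReal hnh
  have hh : (h : ℝ) ≤ 1 / 8 := by
    rw [hdef]; push_cast; rw [div_le_iff₀ hn0]; linarith
  have hh' : 2 * East.gap q * h ≤ 1 := by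
    rw [hdef]; push_cast; rw [mul_div_assoc', div_le_one hn0]; exact hn2
  have hint : ∀ b, Integrable (fun η => (P η).real (East.stayEvent b h n)) (East.eqLaw q) :=
    fun b => Integrable.of_bound
      ((P.measurable_coe (East.Path.canonicalFiltration.le _ _
        (East.measurableSet_stayEvent b h n))).ennreal_toReal).aestronglyMeasurable 1
      (ae_of_all _ fun η => by
        rw [Real.norm_eq_abs, abs_of_nonneg measureReal_nonneg]; exact measureReal_le_one)
  have hle : East.persistence q P t ≤ ∫ η, ((P η).real (East.stayEvent true h n) +
      (P η).real (East.stayEvent false h n)) ∂(East.eqLaw q) := by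
    -- Only the grid events need to be measurable; the persistence event, with its uncountably many
    -- times, is used through monotonicity alone.
    refine integral_mono_of_nonneg (ae_of_all _ fun η => measureReal_nonneg)
      ((hint true).add (hint false)) (ae_of_all _ fun η => ?_)
    refine (measureReal_mono (fun ω hω => ?_)).trans (measureReal_union_le _ _)
    have hstay : ω ∈ East.stayEvent (η 0) h n := fun j hj => hω _ (by
      rw [← hnh]; gcongr)
    cases hη : η 0 with
    | true => exact Or.inl (hη ▸ hstay)
    | false => exact Or.inr (hη ▸ hstay)
  rw [integral_add (hint true) (hint false)] at hle
  have h1 := hP.integral_stayEvent_le true hh hh' n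
  have h2 := hP.integral_stayEvent_le false hh hh' n
  rw [hnh'] at h1 h2
  linarith
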